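/- Let $k$ be a field, $a\ge 1$ an integer and $A=k[[X,Y]]/(X^aY)$. Then $A$ is a one-dimensional noetherian complete intersection local ring, and $$\operatorname{grt}(A)=\operatorname{brt}(A)=a+1 .$$ Here, for an ideal $I$ of $A$, let $\alpha:\mathbf S(I)\to \bigoplus_{n\ge 0}I^nt^n$ be the canonical graded surjection from the symmetric algebra of $I$ onto the Rees algebra of $I$, and $E(I)_n=\ker\alpha_n/(\mathbf S_1(I)\cdot\ker\alpha_{n-1})$. The relation type $\operatorname{rt}(I)$ is the least integer $r\ge 1$ such that $E(I)_n=0$ for all $n\ge r+1$, and $\operatorname{grt}(A)=\sup\{\operatorname{rt}(I): I \text{ an ideal of } A\}$ is the global relation type of $A$. For a one-dimensional noetherian local ring $A$, let $\mathfrak q_1,\dots,\mathfrak q_s$ be the primary components of $(0)$ (in a minimal primary decomposition) that belong to the minimal primes $\mathfrak p_i=\sqrt{\mathfrak q_i}$ of $A$, let $n\ge 1$ be least with $\mathfrak n(A)^n=0$, where $\mathfrak n(A)$ is the nilradical, and let $n_i\ge 1$ be least with $\mathfrak p_i^{n_i}\subseteq \mathfrak q_i$. For a nonempty subset $S\subseteq\{1,\dots,s\}$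 put $t_S=\max\{n_i: i\notin S\}$ (and $t_S=0$ if $S=\{1,\dots,s\}$). Then $$\operatorname{brt}(A)=\max\Bigl(\{n\}\cup\bigl\{e(A/\textstyle\bigcap_{i\in S}\mathfrak q_i)+t_S : \emptyset\ne S\subseteq\{1,\dots,s\}\bigr\}\Bigr),$$ where $e$ denotes the (Hilbert–Samuel) multiplicity of a local ring. A local ring is called a complete intersection if it is the quotient of a regular local ring by an ideal generated by a regular sequence. -/

import Mathlib

noncomputable section

namespace RelationType

universe u

/-- The least integer `n ≥ 1` satisfying `P`, and `⊤` if there is none. -/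
def leastPos (P : ℕ → Prop) : ℕ∞ :=
  sInf {m : ℕ∞ | ∃ n : ℕ, 1 ≤ n ∧ P n ∧ m = n}

section Relations

variable {A : Type u} [CommRing A] (I : Ideal A)

/-- The degree one component of the Rees algebra `⨁ Iⁿ tⁿ ⊆ A[t]`, as the `A`-linear map
`I → A[It]`, `x ↦ x t`. -/
def reesDegreeOne : I →ₗ[A] reesAlgebra I :=
  ((Polynomial.monomial 1 : A →ₗ[A] Polynomial A).comp I.subtype).codRestrict
    (Subalgebra.toSubmodule (reesAlgebra I)) (fun x => by
      have hx : (x : A) ∈ I ^ 1 := by rw [pow_one]; exact x.2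
      exact reesAlgebra.monomial_mem.mpr hx)

/-- The canonical (surjective, graded) morphism `α : S(I) → A[It]` from the symmetric algebra of
`I` to the Rees algebra of `I` that is the identity in degree one. -/
def symToRees : SymmetricAlgebra A I →ₐ[A] reesAlgebra I :=
  SymmetricAlgebra.lift (reesDegreeOne I)

/-- The homogeneous component `S_n(I)` of the symmetric algebra: the `A`-submodule spanned by
products of `n` elements of `I`. -/
def symDegree (n : ℕ) : Submodule A (SymmetricAlgebra A I) :=
  (LinearMap.range (SymmetricAlgebra.ι A I)) ^ n

/-- `ker αₙ`, the kernel of `α` in degree `n`. -/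
def kerDegree (n : ℕ) : Submodule A (SymmetricAlgebra A I) :=
  LinearMap.ker (symToRees I).toLinearMap ⊓ symDegree I n

/-- The module of effective `n`-relations `E(I)ₙ = ker αₙ / S₁(I) · ker αₙ₋₁` of the ideal `I`
(it is zero for `n = 0, 1`, because `α` is injective in degrees `0` and `1`). -/
abbrev EffectiveRelations (n : ℕ) : Type u :=
  kerDegree I n ⧸ (symDegree I 1 * kerDegree I (n - 1)).submoduleOf (kerDegree I n)

/-- The relation type of an ideal: the least `r ≥ 1` such that `E(I)ₙ = 0` for all `n ≥ r + 1`
(and `⊤` if there is none). -/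
def rt : ℕ∞ :=
  leastPos fun r => ∀ n : ℕ, r + 1 ≤ n → Subsingleton (EffectiveRelations I n)

variable (A) in
/-- The global relation type of a ring: the supremum of the relation types of all its ideals. -/
def grt : ℕ∞ := ⨆ I : Ideal A, rt I

end Relations

section Multiplicity

variable {R : Type u} [CommRing R]

/-- The Hilbert–Samuel multiplicity `e(I; R) = lim d! · length(R / Iⁿ) / nᵈ`, `d = dim R`
(a natural number when `R` is noetherian local and `I` is primary to the maximal ideal). For a
local ring `R` with maximal ideal `𝔪`, `e(𝔪; R)` is the multiplicity `e(R)`. -/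
def hilbertSamuelMultiplicity (I : Ideal R) : ℕ :=
  let d : ℕ := ((ringKrullDim R).unbotD 0).toNat
  sInf {e : ℕ | Filter.Tendsto
    (fun n : ℕ => ((d.factorial : ℝ) * ((Module.length R (R ⧸ I ^ n)).toNat : ℝ)) / (n : ℝ) ^ d)
    Filter.atTop (nhds (e : ℝ))}

end Multiplicity

section Brt

variable (A : Type u) [CommRing A]

open Classical in
/-- The minimal primary components of `(0)`: the members of a minimal primary decomposition of
`(0)` whose radical is a minimal prime. (They do not depend on the decomposition.) -/
def minimalPrimaryComponents : Set (Ideal A) :=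
  {q | ∃ t : Finset (Ideal A),
    Submodule.IsMinimalPrimaryDecomposition (⊥ : Ideal A) t ∧ q ∈ t ∧ q.radical ∈ minimalPrimes A}

variable {A} in
/-- The least `n ≥ 1` with `r(q)ⁿ ⊆ q`. -/
def radicalExponent (q : Ideal A) : ℕ∞ := leastPos fun n => q.radical ^ n ≤ q

/-- The least `n ≥ 1` with `𝔫(A)ⁿ = 0`, where `𝔫(A)` is the nilradical. -/
def nilExponent : ℕ∞ := leastPos fun n => nilradical A ^ n = ⊥

/-- `t_S`: the largest radical exponent of a minimal primary component not in `S`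
(and `0` if there is none). -/
def complExponent (S : Set (Ideal A)) : ℕ∞ :=
  ⨆ q ∈ minimalPrimaryComponents A \ S, radicalExponent q

/-- The bound `brt(A)` of a one dimensional noetherian local ring `A`: the maximum of the
nilpotency exponent of the nilradical and of all the numbers `e(A / ⋂ S) + t_S`, where `S` runs
over the nonempty sets of minimal primary components of `(0)`. The maximal ideal of the local ring
`A / ⋂ S` is written as the image of the maximal ideal of `A`. -/
def brt [IsLocalRing A] : ℕ∞ :=
  nilExponent A ⊔
    ⨆ S : Set (Ideal A), ⨆ _ : S ⊆ minimalPrimaryComponents A, ⨆ _ : S.Nonempty,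
      ((hilbertSamuelMultiplicity
          ((IsLocalRing.maximalIdeal A).map (Ideal.Quotient.mk (sInf S))) : ℕ) : ℕ∞)
        + complExponent A S

end Brt

/-- A complete intersection local ring: a quotient of a regular (noetherian) local ring by an
ideal generated by a regular sequence. (This implies the same property of the completion.) -/
def IsCompleteIntersectionLocal (A : Type u) [CommRing A] : Prop :=
  ∃ (R : Type u) (_ : CommRing R) (_ : IsRegularLocalRing R) (rs : List R),
    RingTheory.Sequence.IsRegular R rs ∧ Nonempty ((R ⧸ Ideal.ofList rs) ≃+* A)

/-- The ring `k[[X, Y]] / (Xᵃ Y)`. -/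
abbrev QuotXaY (k : Type u) [Field k] (a : ℕ) : Type u :=
  MvPowerSeries (Fin 2) k ⧸
    (Ideal.span {(MvPowerSeries.X 0 : MvPowerSeries (Fin 2) k) ^ a * MvPowerSeries.X 1} :
      Ideal (MvPowerSeries (Fin 2) k))

end RelationType

end

/-! Write `x`, `y` for the images of `X`, `Y`, and `J = (x)`, `K = (y)`. Then `(0) = Jᵃ ∩ K`, and
`A/J`, `A/K` are quotients of `k[[t]]`, hence principal ideal rings.

Upper bound for `grt`. Every ideal `I` is principal modulo `J` and modulo `K`, and since `A` is
local one `f ∈ I` generates it modulo both (`exists_common_generator`). So `I = (I ∩ J) + (f) = (I ∩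
K) + (f)`, and `(I ∩ J)ᵃ (I ∩ K) = 0` gives `Iᵃ⁺¹ = f Iᵃ` (`pow_succ_le_span_mul_pow`).
Multiplication by `f` is injective on `Iᵃ⁺¹`, so effective relations vanish in all degrees `≥ a + 2`
(`subsingleton_effectiveRelations_of_reduction`).

Lower bound. For the maximal ideal, taking linear parts induces a map from its symmetric algebra to
`k[[X, Y]]`. Relations of degree `a` go to `0`, because multiples of `XᵃY` have order at least `a +
1`; the relation of degree `a + 1` given by `xᵃy = 0` goes to `XᵃY ≠ 0`. It is therefore effective
(`not_subsingleton_effectiveRelations_maximalIdeal`).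

For `brt`, the components of `(0)` are `Jᵃ` and `K`. Removing one variable at a time from a monomial
`f` computes the Hilbert–Samuel function of `k[[X, Y]]/(f)`, so the multiplicities for `Jᵃ`, `K` and
`(0)` are `a`, `1` and `a + 1` (`hilbertSamuelMultiplicity_eq`). Every term of the maximum is then
at most `a + 1`, and the full set of components attains it. -/

noncomputable section
namespace RelationType
open Polynomial
universe u

/-! ### Effective relations and reductions by one element. -/

section General
variable {A : Type u} [CommRing A] (I : Ideal A)

/-- The canonical morphism from the symmetric algebra of `I` to the polynomial ring `A[t]`. -/
def symToPoly : SymmetricAlgebra A I →ₐ[A] A[X] := (reesAlgebra I).val.comp (symToRees I)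

lemma symToPoly_ι (z : I) : symToPoly I (SymmetricAlgebra.ι A I z) = monomial 1 (z : A) := by
  simp [symToPoly, symToRees, reesDegreeOne]
  rfl

lemma mem_kerDegree {n : ℕ} {s : SymmetricAlgebra A I} :
    s ∈ kerDegree I n ↔ symToPoly I s = 0 ∧ s ∈ symDegree I n := by
  simp [kerDegree, symToPoly]

lemma map_monomial_mul (J K : Ideal A) (m n : ℕ) :
    Submodule.map (monomial m : A →ₗ[A] A[X]) J * Submodule.map (monomial n) K =
      Submodule.map (monomial (m + n)) (J * K) := by
  apply le_antisymm
  · rw [Submodule.mul_le]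
    rintro _ ⟨p, hp, rfl⟩ _ ⟨q, hq, rfl⟩
    exact ⟨p * q, Ideal.mul_mem_mul hp hq, by simp [monomial_mul_monomial]⟩
  · rw [Submodule.map_le_iff_le_comap, Ideal.mul_le]
    intro p hp q hq
    simp only [Submodule.mem_comap, ← monomial_mul_monomial]
    exact Submodule.mul_mem_mul ⟨p, hp, rfl⟩ ⟨q, hq, rfl⟩

/-- This is surjectivity of `α` degree by degree: elements of `Iⁿ` lift to forms of degree `n`, and
forms of degree `n` take values in `Iⁿ tⁿ`. -/
lemma map_symToPoly_symDegree (n : ℕ) :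
    (symDegree I n).map (symToPoly I).toLinearMap =
      Submodule.map (monomial n : A →ₗ[A] A[X]) (I ^ n) := by
  have h1 : (LinearMap.range (SymmetricAlgebra.ι A I)).map (symToPoly I).toLinearMap =
      Submodule.map (monomial 1 : A →ₗ[A] A[X]) I := by
    ext p
    simp [Submodule.mem_map, symToPoly_ι]
  rw [symDegree, Submodule.map_pow, h1]
  induction n with
  | zero =>
    rw [pow_zero, pow_zero, Submodule.one_eq_range]
    ext p
    simp [monomial_zero_left, Polynomial.algebraMap_eq]
  | succ n ih => rw [pow_succ, ih, map_monomial_mul, pow_succ]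

lemma exists_symToPoly_eq {n : ℕ} {s : SymmetricAlgebra A I} (hs : s ∈ symDegree I n) :
    ∃ r ∈ I ^ n, symToPoly I s = monomial n r := by
  have : symToPoly I s ∈ (symDegree I n).map (symToPoly I).toLinearMap := ⟨s, hs, rfl⟩
  rw [map_symToPoly_symDegree] at this
  obtain ⟨r, hr, h⟩ := this
  exact ⟨r, hr, h.symm⟩

lemma exists_mem_symDegree {n : ℕ} {r : A} (hr : r ∈ I ^ n) :
    ∃ s ∈ symDegree I n, symToPoly I s = monomial n r := by
  have : (monomial n r : A[X]) ∈ Submodule.map (monomial n : A →ₗ[A] A[X]) (I ^ n) := ⟨r, hr, rfl⟩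
  rw [← map_symToPoly_symDegree] at this
  obtain ⟨s, hs, h⟩ := this
  exact ⟨s, hs, h⟩

lemma symDegree_one : symDegree I 1 = LinearMap.range (SymmetricAlgebra.ι A I) := pow_one _

lemma symDegree_add (m n : ℕ) : symDegree I (m + n) = symDegree I m * symDegree I n := pow_add _ _ _

lemma ι_mem_symDegree_one (z : I) : SymmetricAlgebra.ι A I z ∈ symDegree I 1 := by
  rw [symDegree_one]; exact ⟨z, rfl⟩

lemma subsingleton_effectiveRelations_iff (n : ℕ) :
    Subsingleton (EffectiveRelations I n) ↔ kerDegree I n ≤ symDegree I 1 * kerDegree I (n - 1) := by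
  rw [EffectiveRelations, Submodule.Quotient.subsingleton_iff, Submodule.submoduleOf_eq_top]

/-- If multiplication by `f ∈ I` maps `Iⁿ` onto `Iⁿ⁺¹` and is injective on `Iⁿ⁺¹`, there are no
effective relations of degree `n + 2`. -/
lemma subsingleton_effectiveRelations_of_reduction {n : ℕ} {f : A} (hf : f ∈ I)
    (hred : I ^ (n + 1) ≤ Ideal.span {f} * I ^ n) (hinj : ∀ w ∈ I ^ (n + 1), f * w = 0 → w = 0) :
    Subsingleton (EffectiveRelations I (n + 2)) := by
  rw [subsingleton_effectiveRelations_iff, show n + 2 - 1 = n + 1 from rfl]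
  set T := SymmetricAlgebra.ι A I ⟨f, hf⟩ with hT
  have hTf : symToPoly I T = monomial 1 f := symToPoly_ι I ⟨f, hf⟩
  have hT1 : T ∈ symDegree I 1 := ι_mem_symDegree_one I _
  -- Since `Iⁿ⁺¹ = f Iⁿ`, a form of degree `n + 1` is divisible by `T` up to a relation of the same
  -- degree.
  have key : ∀ w ∈ symDegree I (n + 1), ∃ v ∈ symDegree I n, w - T * v ∈ kerDegree I (n + 1) := by
    intro w hw
    obtain ⟨r, hr, hwr⟩ := exists_symToPoly_eq I hw
    obtain ⟨r', hr', rfl⟩ := Ideal.mem_span_singleton_mul.mp (hred hr)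
    obtain ⟨v, hv, hvr⟩ := exists_mem_symDegree I hr'
    refine ⟨v, hv, (mem_kerDegree I).2 ⟨?_, ?_⟩⟩
    · rw [map_sub, map_mul, hwr, hTf, hvr, monomial_mul_monomial, add_comm 1 n, sub_self]
    · refine Submodule.sub_mem _ hw ?_
      rw [add_comm, symDegree_add]
      exact Submodule.mul_mem_mul hT1 hv
  -- One more linear factor turns that error into an element of `S₁ · ker αₙ₊₁`.
  have key2 : ∀ s ∈ symDegree I (n + 2), ∃ v ∈ symDegree I (n + 1),
      s - T * v ∈ symDegree I 1 * kerDegree I (n + 1) := by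
    intro s hs
    rw [show n + 2 = 1 + (n + 1) by ring, symDegree_add] at hs
    induction hs using Submodule.mul_induction_on' with
    | mem_mul_mem z hz w hw =>
      obtain ⟨v, hv, hwv⟩ := key w hw
      refine ⟨z * v, ?_, ?_⟩
      · rw [add_comm, symDegree_add]
        exact Submodule.mul_mem_mul hz hv
      · rw [show z * w - T * (z * v) = z * (w - T * v) by ring]
        exact Submodule.mul_mem_mul hz hwv
    | add s _ t _ hs ht =>
      obtain ⟨v, hv, h⟩ := hs
      obtain ⟨v', hv', h'⟩ := ht
      refine ⟨v + v', add_mem hv hv', ?_⟩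
      rw [show s + t - T * (v + v') = (s - T * v) + (t - T * v') by ring]
      exact add_mem h h'
  intro s hs
  rw [mem_kerDegree] at hs
  obtain ⟨v, hv, h⟩ := key2 s hs.2
  have hker : symDegree I 1 * kerDegree I (n + 1) ≤ LinearMap.ker (symToPoly I).toLinearMap := by
    rw [Submodule.mul_le]
    intro z _ w hw
    simp [((mem_kerDegree I).1 hw).1]
  have h0 : symToPoly I (s - T * v) = 0 := hker h
  obtain ⟨r, hr, hvr⟩ := exists_symToPoly_eq I hv
  rw [map_sub, hs.1, zero_sub, neg_eq_zero, map_mul, hTf, hvr, monomial_mul_monomial,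
    monomial_eq_zero_iff] at h0
  -- If `s` is a relation, then `f` kills the value of the quotient `v`; by injectivity `v` is
  -- itself a relation, so `T * v` is not effective either.
  have hv0 : v ∈ kerDegree I (n + 1) :=
    (mem_kerDegree I).2 ⟨by rw [hvr, hinj r hr h0, map_zero], hv⟩
  have := add_mem h (Submodule.mul_mem_mul hT1 hv0)
  rwa [sub_add_cancel] at this

end General

lemma leastPos_le {P : ℕ → Prop} {n : ℕ} (hn : 1 ≤ n) (h : P n) : leastPos P ≤ n :=
  sInf_le ⟨n, hn, h, rfl⟩

lemma le_leastPos {P : ℕ → Prop} {m : ℕ∞} (h : ∀ n : ℕ, 1 ≤ n → P n → m ≤ n) : m ≤ leastPos P :=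
  le_sInf (by rintro _ ⟨n, hn, hP, rfl⟩; exact h n hn hP)

/-! ### Upper bound for the relation type. -/

section Upper
variable {A : Type u} [CommRing A]

/-- In a local ring, an ideal whose image modulo `J` is principal is generated modulo `J` by each
of its elements outside some smaller ideal `N`, unless it is contained in `J`. -/
lemma exists_ideal_avoiding_generators [IsLocalRing A] (J : Ideal A) [IsPrincipalIdealRing (A ⧸ J)]
    (I : Ideal A) : ∃ N : Ideal A, (∀ f ∈ I, f ∉ N → ∀ z ∈ I, ∃ u, z - u * f ∈ J) ∧
      (I ≤ N → I ≤ J) := by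
  obtain ⟨β, hβ⟩ := IsPrincipalIdealRing.principal (I.map (Ideal.Quotient.mk J))
  rw [Ideal.submodule_span_eq] at hβ
  have hmem : ∀ z ∈ I, ∃ c, Ideal.Quotient.mk J z = Ideal.Quotient.mk J c * β := by
    intro z hz
    have := Ideal.mem_map_of_mem (Ideal.Quotient.mk J) hz
    rw [hβ, Ideal.mem_span_singleton'] at this
    obtain ⟨c, hc⟩ := this
    obtain ⟨c, rfl⟩ := Ideal.Quotient.mk_surjective c
    exact ⟨c, hc.symm⟩
  -- `N` is the preimage of `𝔪β`, with `β` a generator of the image of `I`: an element `cβ` outside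
  -- `𝔪β` has `c` a unit.
  refine ⟨((IsLocalRing.maximalIdeal A).map (Ideal.Quotient.mk J) * Ideal.span {β}).comap
    (Ideal.Quotient.mk J), fun f hf hfN z hz => ?_, fun h => ?_⟩
  · obtain ⟨c, hc⟩ := hmem f hf
    obtain ⟨d, hd⟩ := hmem z hz
    have hcu : IsUnit c := by
      by_contra hcu
      apply hfN
      rw [Ideal.mem_comap, hc]
      exact Ideal.mul_mem_mul (Ideal.mem_map_of_mem _ hcu) (Ideal.mem_span_singleton_self β)
    obtain ⟨e, he⟩ := hcu.exists_left_inv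
    refine ⟨d * e, ?_⟩
    rw [← Ideal.Quotient.eq_zero_iff_mem, map_sub, map_mul, hc, hd, ← mul_assoc, ← map_mul,
      mul_assoc, he, mul_one, sub_self]
  -- Nakayama for one generator: `β = mβ` with `m ∈ 𝔪` forces `β = 0`.
  · have hβI : β ∈ I.map (Ideal.Quotient.mk J) := hβ ▸ Ideal.mem_span_singleton_self β
    have hβN := Ideal.map_le_iff_le_comap.2 h hβI
    rw [Ideal.mem_mul_span_singleton] at hβN
    obtain ⟨m, hm, hmβ⟩ := hβN
    obtain ⟨m, hm', rfl⟩ := (Ideal.mem_map_iff_of_surjective _ Ideal.Quotient.mk_surjective).1 hm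
    have hu : IsUnit (Ideal.Quotient.mk J (1 - m)) :=
      (IsLocalRing.isUnit_one_sub_self_of_mem_nonunits m hm').map _
    have hβ0 : β = 0 := by
      rw [← hu.mul_right_eq_zero, map_sub, map_one, sub_mul, one_mul, hmβ, sub_self]
    rw [← Ideal.mk_ker (I := J), RingHom.ker, ← Ideal.map_le_iff_le_comap, hβ, hβ0]
    simp

/-- An ideal of a local ring that is principal modulo `J` and modulo `K` is generated modulo both
by one of its elements. -/
lemma exists_common_generator [IsLocalRing A] (J K : Ideal A) [IsPrincipalIdealRing (A ⧸ J)]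
    [IsPrincipalIdealRing (A ⧸ K)] (I : Ideal A) :
    ∃ f ∈ I, (∀ z ∈ I, ∃ u, z - u * f ∈ J) ∧ ∀ z ∈ I, ∃ u, z - u * f ∈ K := by
  obtain ⟨N, hN, hN'⟩ := exists_ideal_avoiding_generators J I
  obtain ⟨P, hP, hP'⟩ := exists_ideal_avoiding_generators K I
  have triv : ∀ {J : Ideal A}, I ≤ J → ∀ f : A, ∀ z ∈ I, ∃ u, z - u * f ∈ J :=
    fun h f z hz => ⟨0, by simpa using h hz⟩
  by_cases h1 : I ≤ N
  · by_cases h2 : I ≤ P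
    · exact ⟨0, I.zero_mem, triv (hN' h1) 0, triv (hP' h2) 0⟩
    · obtain ⟨f, hf, hfP⟩ := SetLike.not_le_iff_exists.1 h2
      exact ⟨f, hf, triv (hN' h1) f, hP f hf hfP⟩
  · obtain ⟨f, hf, hfN⟩ := SetLike.not_le_iff_exists.1 h1
    by_cases h2 : I ≤ P
    · exact ⟨f, hf, hN f hf hfN, triv (hP' h2) f⟩
    · obtain ⟨g, hg, hgP⟩ := SetLike.not_le_iff_exists.1 h2
      by_cases hfP : f ∈ P
      · by_cases hgN : g ∈ N
        -- Two proper subgroups do not cover: with `f ∈ P \ N` and `g ∈ N \ P`, the sum avoids both.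
        · refine ⟨f + g, add_mem hf hg, hN _ (add_mem hf hg) ?_, hP _ (add_mem hf hg) ?_⟩
          · rwa [Ideal.add_mem_iff_left _ hgN]
          · rwa [Ideal.add_mem_iff_right _ hfP]
        · exact ⟨g, hg, hN g hg hgN, hP g hg hgP⟩
      · exact ⟨f, hf, hN f hf hfN, hP f hf hfP⟩

/-- Expand `n` of the factors along `J + L`: either all are taken in `J`, or one lies in `L` and the
other `n` stay in `I`. The last factor is left whole so that it can be split along a different
ideal. -/
lemma pow_mul_le_of_le_sup {I J L : Ideal A} (hJ : J ≤ I) (h : I ≤ J ⊔ L) (n : ℕ) :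
    I ^ n * I ≤ J ^ n * I ⊔ L * I ^ n := by
  induction n with
  | zero => simp
  | succ n ih =>
    calc I ^ (n + 1) * I = I ^ n * I * I := by rw [pow_succ]
      _ ≤ (J ^ n * I ⊔ L * I ^ n) * I := Ideal.mul_mono_left ih
      _ = J ^ n * I * I ⊔ L * I ^ (n + 1) := by rw [Ideal.sup_mul, mul_assoc L, ← pow_succ]
      _ ≤ J ^ n * (J ⊔ L) * I ⊔ L * I ^ (n + 1) :=
        sup_le_sup_right (Ideal.mul_mono_left (Ideal.mul_mono_right h)) _
      _ = J ^ (n + 1) * I ⊔ L * (J ^ n * I) ⊔ L * I ^ (n + 1) := by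
        rw [Ideal.mul_sup, Ideal.sup_mul, ← pow_succ, mul_comm (J ^ n) L, mul_assoc L]
      _ ≤ J ^ (n + 1) * I ⊔ L * I ^ (n + 1) := by
        refine sup_le (sup_le le_sup_left (le_sup_of_le_right ?_)) le_sup_right
        rw [pow_succ]
        exact Ideal.mul_mono_right (Ideal.mul_mono_left (Ideal.pow_right_mono hJ n))

/-- If `Jᵃ K = 0` and `f ∈ I` generates `I` modulo `J` and modulo `K`, then `Iᵃ⁺¹ = f Iᵃ`. -/
lemma pow_succ_le_span_mul_pow {I J K : Ideal A} {a : ℕ} (h0 : J ^ a * K = ⊥) {f : A} (hf : f ∈ I)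
    (hJ : ∀ z ∈ I, ∃ u, z - u * f ∈ J) (hK : ∀ z ∈ I, ∃ u, z - u * f ∈ K) :
    I ^ (a + 1) ≤ Ideal.span {f} * I ^ a := by
  -- Splitting along `I ⊓ J` rather than `J` keeps the cofactors of `f` in powers of `I`.
  have key : ∀ {J : Ideal A}, (∀ z ∈ I, ∃ u, z - u * f ∈ J) → I ≤ (I ⊓ J) ⊔ Ideal.span {f} := by
    intro J hJ z hz
    obtain ⟨u, hu⟩ := hJ z hz
    exact Submodule.mem_sup.2 ⟨_, ⟨sub_mem hz (I.mul_mem_left u hf), hu⟩, u * f,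
      Ideal.mem_span_singleton'.2 ⟨u, rfl⟩, by ring⟩
  calc I ^ (a + 1) = I ^ a * I := pow_succ _ _
    _ ≤ (I ⊓ J) ^ a * I ⊔ Ideal.span {f} * I ^ a := pow_mul_le_of_le_sup inf_le_left (key hJ) a
    _ ≤ (I ⊓ J) ^ a * (I ⊓ K ⊔ Ideal.span {f}) ⊔ Ideal.span {f} * I ^ a :=
      sup_le_sup_right (Ideal.mul_mono_right (key hK)) _
    _ = (I ⊓ J) ^ a * (I ⊓ K) ⊔ Ideal.span {f} * (I ⊓ J) ^ a ⊔ Ideal.span {f} * I ^ a := by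
      rw [Ideal.mul_sup, mul_comm _ (Ideal.span {f})]
    _ ≤ Ideal.span {f} * I ^ a := by
      refine sup_le (sup_le ?_ ?_) le_rfl
      · refine le_trans (Ideal.mul_mono (Ideal.pow_right_mono inf_le_right a) inf_le_right) ?_
        rw [h0]
        exact bot_le
      · exact Ideal.mul_mono_right (Ideal.pow_right_mono inf_le_left a)

/-- The relation type of an ideal of a local ring in which `(0) = Jᵃ ∩ K` with `Jᵃ` and `K`
primary and `A / J`, `A / K` principal ideal rings. -/
lemma rt_le_of_isPrincipalIdealRing_quotient [IsLocalRing A] (J K : Ideal A)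
    [IsPrincipalIdealRing (A ⧸ J)] [IsPrincipalIdealRing (A ⧸ K)] {a : ℕ}
    (hJ : ∀ f w, f * w = 0 → f ∉ J → w ∈ J ^ a) (hK : ∀ f w, f * w = 0 → f ∉ K → w ∈ K)
    (h0 : J ^ a ⊓ K = ⊥) (I : Ideal A) : rt I ≤ (a : ℕ∞) + 1 := by
  have h0' : J ^ a * K = ⊥ := le_bot_iff.1 (Ideal.mul_le_inf.trans h0.le)
  obtain ⟨f, hf, hfJ, hfK⟩ := exists_common_generator J K I
  have hsub : ∀ {J : Ideal A}, (∀ z ∈ I, ∃ u, z - u * f ∈ J) → f ∈ J → I ≤ J := by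
    intro J hJ hfJ z hz
    obtain ⟨u, hu⟩ := hJ z hz
    simpa using add_mem hu (J.mul_mem_left u hfJ)
  have hred := pow_succ_le_span_mul_pow h0' hf hfJ hfK
  -- For each of `J` and `K`: either `f` lies outside and can be cancelled, or `f` lies inside and
  -- drags all of `I`, hence `w`, along.
  have hinj : ∀ w ∈ I ^ (a + 1), f * w = 0 → w = 0 := by
    intro w hw hfw
    rw [← Ideal.mem_bot, ← h0]
    constructor
    · by_cases h : f ∈ J
      · exact Ideal.pow_le_pow_right (Nat.le_succ a) (Ideal.pow_right_mono (hsub hfJ h) _ hw)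
      · exact hJ f w hfw h
    · by_cases h : f ∈ K
      · exact hsub hfK h (Ideal.pow_le_self (Nat.succ_ne_zero a) hw)
      · exact hK f w hfw h
  refine le_trans (leastPos_le (n := a + 1) (Nat.le_add_left 1 a) fun n hn => ?_) (by simp)
  obtain ⟨m, rfl⟩ := Nat.exists_eq_add_of_le hn
  rw [show a + 1 + 1 + m = (a + m) + 2 by ring]
  refine subsingleton_effectiveRelations_of_reduction I hf ?_
    fun w hw => hinj w (Ideal.pow_le_pow_right (by lia) hw)
  rw [show a + m + 1 = (a + 1) + m by ring, pow_add _ (a + 1), pow_add _ a m, ← mul_assoc]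
  exact Ideal.mul_mono_left hred

end Upper
end RelationType
end

noncomputable section
namespace RelationType
open MvPowerSeries
universe u

/-! ### The ring `k[[X, Y]]`: order filtration, dimension, regularity, prime variables. -/

section PowerSeriesRing
variable {k : Type u} [Field k]

lemma eq_or_eq_of_ne {s t : Fin 2} (h : s ≠ t) (i : Fin 2) : i = s ∨ i = t := by
  fin_cases s <;> fin_cases t <;> fin_cases i <;> simp_all

lemma order_X (s : Fin 2) : (X s : MvPowerSeries (Fin 2) k).order = 1 := by
  rw [X_def, order_monomial_of_ne_zero one_ne_zero]
  simp

/-- Splitting off the terms divisible by `X s`. -/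
lemma exists_eq_X_mul_add (s : Fin 2) (F : MvPowerSeries (Fin 2) k) :
    ∃ G H : MvPowerSeries (Fin 2) k, F = X s * G + H ∧ F.order ≤ (X s * G).order ∧
      ∀ m : Fin 2 →₀ ℕ, coeff m H = if m s = 0 then coeff m F else 0 := by
  let H : MvPowerSeries (Fin 2) k := fun m => if m s = 0 then coeff m F else 0
  have hH : ∀ m, coeff m H = if m s = 0 then coeff m F else 0 := fun m => rfl
  have hd : (X s : MvPowerSeries (Fin 2) k) ∣ F - H := by
    rw [X_dvd_iff]
    intro m hm
    rw [map_sub, hH, if_pos hm, sub_self]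
  obtain ⟨G, hG⟩ := hd
  refine ⟨G, H, by rw [← hG]; ring, ?_, hH⟩
  rw [← hG]
  refine le_order fun m hm => ?_
  rw [map_sub, hH, coeff_of_lt_order hm]
  simp

lemma le_order_of_succ_le_order_X_mul {s : Fin 2} {n : ℕ} {G : MvPowerSeries (Fin 2) k}
    (h : ((n + 1 : ℕ) : ℕ∞) ≤ (X s * G).order) : (n : ℕ∞) ≤ G.order := by
  rw [order_mul, order_X, add_comm 1, Nat.cast_add, Nat.cast_one] at h
  exact (ENat.add_le_add_iff_right ENat.one_ne_top).1 h

/-- Write `F = X s * G + H` with no `X s` in `H`. As `H` has no constant term it is a multiple of `X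
t`, and both cofactors have order one less. -/
lemma mem_span_pow_of_le_order {s t : Fin 2} (h : s ≠ t) {n : ℕ} {F : MvPowerSeries (Fin 2) k}
    (hF : (n : ℕ∞) ≤ F.order) : F ∈ Ideal.span {X s, X t} ^ n := by
  induction n generalizing F with
  | zero => simp
  | succ n ih =>
    obtain ⟨G, H, rfl, hG, hH⟩ := exists_eq_X_mul_add s F
    have hHord : ((n + 1 : ℕ) : ℕ∞) ≤ H.order := by
      refine le_order fun m hm => ?_
      rw [hH, coeff_of_lt_order (hm.trans_le hF), ite_self]
    have hd : (X t : MvPowerSeries (Fin 2) k) ∣ H := by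
      rw [X_dvd_iff]
      intro m hm
      rw [hH]
      split_ifs with hs
      · have hm0 : m = 0 := by
          ext i
          rcases eq_or_eq_of_ne h i with rfl | rfl <;> simpa
        refine coeff_of_lt_order (lt_of_lt_of_le ?_ hF)
        simp [hm0]
      · rfl
    obtain ⟨H', rfl⟩ := hd
    rw [pow_succ']
    exact add_mem (Ideal.mul_mem_mul (Ideal.subset_span (by simp))
      (ih (le_order_of_succ_le_order_X_mul (hF.trans hG))))
      (Ideal.mul_mem_mul (Ideal.subset_span (by simp)) (ih (le_order_of_succ_le_order_X_mul hHord)))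

lemma mem_maximalIdeal_iff_order {F : MvPowerSeries (Fin 2) k} :
    F ∈ IsLocalRing.maximalIdeal (MvPowerSeries (Fin 2) k) ↔ 1 ≤ F.order := by
  rw [one_le_order_iff_constCoeff_eq_zero, IsLocalRing.mem_maximalIdeal, mem_nonunits_iff,
    isUnit_iff_constantCoeff, isUnit_iff_ne_zero, not_not]

lemma maximalIdeal_eq_span {s t : Fin 2} (h : s ≠ t) :
    IsLocalRing.maximalIdeal (MvPowerSeries (Fin 2) k) = Ideal.span {X s, X t} := by
  apply le_antisymm
  · intro F hF
    rw [← pow_one (Ideal.span _)]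
    exact mem_span_pow_of_le_order h (by exact_mod_cast mem_maximalIdeal_iff_order.1 hF)
  · rw [Ideal.span_le]
    rintro _ (rfl | rfl) <;> exact mem_maximalIdeal_iff_order.2 (order_X _).ge

lemma X_mem_maximalIdeal (s : Fin 2) :
    X s ∈ IsLocalRing.maximalIdeal (MvPowerSeries (Fin 2) k) :=
  mem_maximalIdeal_iff_order.2 (order_X _).ge

lemma mem_maximalIdeal_pow_iff {n : ℕ} {F : MvPowerSeries (Fin 2) k} :
    F ∈ IsLocalRing.maximalIdeal (MvPowerSeries (Fin 2) k) ^ n ↔ (n : ℕ∞) ≤ F.order := by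
  refine ⟨fun h => ?_, fun h => ?_⟩
  · induction n generalizing F with
    | zero => simp
    | succ n ih =>
      rw [pow_succ'] at h
      induction h using Submodule.mul_induction_on' with
      | mem_mul_mem p hp q hq =>
        rw [order_mul, add_comm n, Nat.cast_add, Nat.cast_one]
        exact add_le_add (mem_maximalIdeal_iff_order.1 hp) (ih hq)
      | add p _ q _ hp hq => exact (le_min hp hq).trans min_order_le_add
  · rw [maximalIdeal_eq_span (zero_ne_one : (0 : Fin 2) ≠ 1)]
    exact mem_span_pow_of_le_order zero_ne_one h

/-- Adjoining one power series variable raises the dimension by at least one; this is done twice,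
starting from no variables. -/
lemma two_le_ringKrullDim : 2 ≤ ringKrullDim (MvPowerSeries (Fin 2) k) := by
  rw [ringKrullDim_eq_of_ringEquiv (finSuccEquiv k 1).toRingEquiv]
  refine le_trans ?_ ringKrullDim_succ_le_ringKrullDim_powerseries
  rw [ringKrullDim_eq_of_ringEquiv (finSuccEquiv k 0).toRingEquiv]
  refine le_trans ?_ (add_le_add_left ringKrullDim_succ_le_ringKrullDim_powerseries 1)
  have h : 0 ≤ ringKrullDim (MvPowerSeries (Fin 0) k) := ringKrullDim_nonneg_of_nontrivial
  calc (2 : WithBot ℕ∞) = 0 + 1 + 1 := by norm_num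
    _ ≤ _ := by gcongr

lemma spanFinrank_span_pair_le {R : Type u} [CommRing R] (x y : R) :
    (Ideal.span {x, y}).spanFinrank ≤ 2 := by
  have h := Submodule.spanFinrank_span_le_ncard_of_finite (R := R) (Set.toFinite {x, y})
  exact h.trans ((Set.ncard_insert_le _ _).trans (by simp))

/-- Two generators of the maximal ideal and dimension at least two suffice; the exact dimension is
then a consequence of regularity. -/
instance isRegularLocalRing_mvPowerSeries : IsRegularLocalRing (MvPowerSeries (Fin 2) k) := by
  refine IsRegularLocalRing.of_spanFinrank_maximalIdeal_le _ (le_trans ?_ two_le_ringKrullDim)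
  rw [maximalIdeal_eq_span (zero_ne_one : (0 : Fin 2) ≠ 1)]
  exact_mod_cast spanFinrank_span_pair_le _ _

lemma ringKrullDim_mvPowerSeries : ringKrullDim (MvPowerSeries (Fin 2) k) = 2 := by
  refine le_antisymm ?_ two_le_ringKrullDim
  rw [← IsRegularLocalRing.spanFinrank_maximalIdeal,
    maximalIdeal_eq_span (zero_ne_one : (0 : Fin 2) ≠ 1)]
  exact_mod_cast spanFinrank_span_pair_le _ _

lemma ringKrullDim_quotient_span_singleton {F : MvPowerSeries (Fin 2) k} (h0 : F ≠ 0)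
    (hF : F ∈ IsLocalRing.maximalIdeal (MvPowerSeries (Fin 2) k)) :
    ringKrullDim (MvPowerSeries (Fin 2) k ⧸ Ideal.span {F}) = 1 := by
  have h := ringKrullDim_quotient_span_singleton_succ_eq_ringKrullDim_of_mem_nonZeroDivisors
    (mem_nonZeroDivisors_of_ne_zero h0) hF
  rw [ringKrullDim_mvPowerSeries] at h
  generalize ringKrullDim (MvPowerSeries (Fin 2) k ⧸ Ideal.span {F}) = d at h
  induction d with
  | bot => simp at h
  | coe d =>
    have h' : d + 1 = 1 + 1 := WithBot.coe_injective h
    rw [ENat.add_left_injective_of_ne_top ENat.one_ne_top h']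
    rfl

lemma isCompleteIntersectionLocal_quotient {F : MvPowerSeries (Fin 2) k} (h0 : F ≠ 0)
    (hF : F ∈ IsLocalRing.maximalIdeal (MvPowerSeries (Fin 2) k)) :
    IsCompleteIntersectionLocal (MvPowerSeries (Fin 2) k ⧸ Ideal.span {F}) := by
  refine ⟨MvPowerSeries (Fin 2) k, inferInstance, inferInstance, [F], ?_, ?_⟩
  · refine ⟨?_, ?_⟩
    · rw [RingTheory.Sequence.isWeaklyRegular_singleton_iff]
      exact IsSMulRegular.of_right_eq_zero_of_smul fun x hx => by simpa [h0] using hx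
    · rw [Ideal.ofList_singleton, smul_eq_mul, Ideal.mul_top]
      intro h
      rw [eq_comm, Ideal.span_singleton_eq_top] at h
      exact hF h
  · rw [Ideal.ofList_singleton]
    exact ⟨RingEquiv.refl _⟩

/-- Setting `X s` to zero is a ring morphism onto power series in `X t` alone, with kernel `(X s)`.
This yields both primality of `X s` and principality of quotients killing it. -/
lemma X_dvd_iff_killCompl {s t : Fin 2} (h : s ≠ t) {F : MvPowerSeries (Fin 2) k} :
    X s ∣ F ↔ killCompl (R := k) (Function.Embedding.punit.{1} t) F = 0 := by
  rw [X_dvd_iff, MvPowerSeries.ext_iff]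
  constructor
  · intro H x
    rw [coeff_killCompl, H, coeff_zero]
    rw [Finsupp.embDomain_of_notMem_range]
    rintro ⟨_, hx⟩
    exact h hx.symm
  · intro H m hm
    have := H (Finsupp.single PUnit.unit (m t))
    rw [coeff_killCompl, coeff_zero, Finsupp.embDomain_single] at this
    have hm' : m = Finsupp.single t (m t) := by
      ext i
      rcases eq_or_eq_of_ne h i with rfl | rfl
      · rw [hm, Finsupp.single_eq_of_ne h]
      · simp
    rw [hm']
    exact this

lemma exists_ne_fin_two (s : Fin 2) : ∃ t, s ≠ t := by
  obtain ⟨t, ht⟩ := exists_ne s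
  exact ⟨t, ht.symm⟩

lemma prime_X (s : Fin 2) : Prime (X s : MvPowerSeries (Fin 2) k) := by
  obtain ⟨t, h⟩ := exists_ne_fin_two s
  refine ⟨fun h0 => ?_, X_mem_maximalIdeal s, fun F G hFG => ?_⟩
  · simpa [h0] using order_X (k := k) s
  · rwa [X_dvd_iff_killCompl h, map_mul, mul_eq_zero, ← X_dvd_iff_killCompl h,
      ← X_dvd_iff_killCompl h] at hFG

lemma not_X_dvd_X {s t : Fin 2} (h : s ≠ t) : ¬ (X s : MvPowerSeries (Fin 2) k) ∣ X t := by
  rw [X_dvd_iff]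
  intro H
  have := H (Finsupp.single t 1) (Finsupp.single_eq_of_ne h)
  simp at this

/-- A quotient of `k[[X, Y]]` in which one of the variables vanishes is principal. -/
lemma isPrincipalIdealRing_of_surjective {B : Type u} [CommRing B] (π : MvPowerSeries (Fin 2) k →+* B)
    (hπ : Function.Surjective π) (s : Fin 2) (hs : π (X s) = 0) : IsPrincipalIdealRing B := by
  obtain ⟨t, h⟩ := exists_ne_fin_two s
  refine IsPrincipalIdealRing.of_surjective (R := PowerSeries k)
    (π.comp (rename (R := k) (Function.Embedding.punit.{1} t)).toRingHom) fun b => ?_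
  obtain ⟨F, rfl⟩ := hπ b
  refine ⟨killCompl (R := k) (Function.Embedding.punit.{1} t) F, ?_⟩
  have hd : X s ∣ F - rename (Function.Embedding.punit.{1} t)
      (killCompl (R := k) (Function.Embedding.punit.{1} t) F) := by
    rw [X_dvd_iff_killCompl h, map_sub, killCompl_rename_app, sub_self]
  obtain ⟨G, hG⟩ := hd
  have := congrArg π hG
  rw [map_sub, map_mul, hs, zero_mul, sub_eq_zero] at this
  exact this.symm

end PowerSeriesRing
end RelationType
end

/-! ### Hilbert–Samuel functions of monomial quotients of `k[[X, Y]]`. -/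

noncomputable section
namespace RelationType
open MvPowerSeries
universe u v

/-- The hypothesis says `K = (J : x)`, so multiplication by `x` gives the exact sequence `0 → R/K →
R/J → R/(J + (x)) → 0`. -/
lemma length_quotient_eq_add {R : Type u} [CommRing R] {J K : Ideal R} {x : R}
    (hK : ∀ r, x * r ∈ J ↔ r ∈ K) :
    Module.length R (R ⧸ J) =
      Module.length R (R ⧸ K) + Module.length R (R ⧸ (J ⊔ Ideal.span {x})) := by
  have hle : K ≤ Submodule.comap (LinearMap.mulLeft R x) J := fun r hr => (hK r).2 hr
  refine Module.length_eq_add_of_exact (Submodule.mapQ K J (LinearMap.mulLeft R x) hle)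
    (Submodule.mapQ J (J ⊔ Ideal.span {x}) LinearMap.id le_sup_left) ?_ ?_ ?_
  · rw [← LinearMap.ker_eq_bot, Submodule.ker_mapQ, ← le_bot_iff, Submodule.map_le_iff_le_comap,
      ← LinearMap.ker, Submodule.ker_mkQ]
    exact fun r hr => (hK r).1 hr
  · intro b
    obtain ⟨b, rfl⟩ := Submodule.mkQ_surjective _ b
    exact ⟨J.mkQ b, rfl⟩
  · rw [LinearMap.exact_iff, Submodule.ker_mapQ, Submodule.range_mapQ]
    apply le_antisymm
    · rintro _ ⟨r, hr, rfl⟩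
      obtain ⟨j, hj, z, hz, rfl⟩ := Submodule.mem_sup.1 hr
      obtain ⟨c, rfl⟩ := Ideal.mem_span_singleton'.1 hz
      refine ⟨x * c, ⟨c, rfl⟩, ?_⟩
      rw [map_add, Submodule.mkQ_apply J j, (Submodule.Quotient.mk_eq_zero J).2 hj, zero_add, mul_comm]
    · rintro _ ⟨_, ⟨c, rfl⟩, rfl⟩
      exact ⟨_, Submodule.mem_sup_right (Ideal.mul_mem_right c _ (Ideal.mem_span_singleton_self x)), rfl⟩

section PowerSeriesRing
variable {k : Type u} [Field k]

local notation "𝔪" => IsLocalRing.maximalIdeal (MvPowerSeries (Fin 2) k)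

lemma length_quotient_maximalIdeal : Module.length (MvPowerSeries (Fin 2) k)
    (MvPowerSeries (Fin 2) k ⧸ 𝔪) = 1 := by
  rw [Module.length_eq_one_iff, isSimpleModule_iff_isCoatom]
  exact (IsLocalRing.maximalIdeal.isMaximal _).out

/-- A colon ideal for the exact sequence: multiplication by `X s` raises the order by exactly one.
-/
lemma X_mul_mem_iff (s : Fin 2) (F : MvPowerSeries (Fin 2) k) (n : ℕ) (G : MvPowerSeries (Fin 2) k) :
    X s * G ∈ Ideal.span {X s * F} ⊔ 𝔪 ^ (n + 1) ↔ G ∈ Ideal.span {F} ⊔ 𝔪 ^ n := by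
  constructor
  · intro h
    obtain ⟨j, hj, z, hz, hjz⟩ := Submodule.mem_sup.1 h
    obtain ⟨c, rfl⟩ := Ideal.mem_span_singleton'.1 hj
    obtain rfl : z = X s * (G - c * F) := by rw [mul_sub, ← hjz]; ring
    refine Submodule.mem_sup.2 ⟨c * F, Ideal.mem_span_singleton'.2 ⟨c, rfl⟩, G - c * F, ?_, by ring⟩
    rw [mem_maximalIdeal_pow_iff] at hz ⊢
    exact le_order_of_succ_le_order_X_mul hz
  · intro h
    obtain ⟨j, hj, z, hz, rfl⟩ := Submodule.mem_sup.1 h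
    obtain ⟨c, rfl⟩ := Ideal.mem_span_singleton'.1 hj
    rw [mul_add]
    refine add_mem (Ideal.mem_sup_left (Ideal.mem_span_singleton'.2 ⟨c, by ring⟩))
      (Ideal.mem_sup_right ?_)
    rw [pow_succ']
    exact Ideal.mul_mem_mul (X_mem_maximalIdeal s) hz

/-- Modulo `X s`, the ideal `𝔪ⁿ⁺¹` is `X t` times `𝔪ⁿ`, and `X t` can be cancelled because `X s` is
prime. -/
lemma X_mul_mem_iff_of_ne {s t : Fin 2} (h : s ≠ t) (n : ℕ) (G : MvPowerSeries (Fin 2) k) :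
    X t * G ∈ Ideal.span {X s} ⊔ 𝔪 ^ (n + 1) ↔ G ∈ Ideal.span {X s} ⊔ 𝔪 ^ n := by
  constructor
  · intro hG
    obtain ⟨j, hj, z, hz, hjz⟩ := Submodule.mem_sup.1 hG
    obtain ⟨c, rfl⟩ := Ideal.mem_span_singleton'.1 hj
    have hle : 𝔪 ^ (n + 1) ≤ Ideal.span {X s} ⊔ Ideal.span {X t} * 𝔪 ^ n := by
      rw [pow_succ']
      nth_rewrite 1 [maximalIdeal_eq_span h]
      rw [Ideal.span_insert, Ideal.sup_mul]
      exact sup_le_sup_right Ideal.mul_le_left _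
    obtain ⟨j', hj', z', hz', rfl⟩ := Submodule.mem_sup.1 (hle hz)
    obtain ⟨c', rfl⟩ := Ideal.mem_span_singleton'.1 hj'
    obtain ⟨w, hw, rfl⟩ := Ideal.mem_span_singleton_mul.1 hz'
    have hd : X s ∣ X t * (G - w) := ⟨c + c', by rw [mul_sub, ← hjz]; ring⟩
    obtain ⟨e, he⟩ := ((prime_X s).dvd_or_dvd hd).resolve_left (not_X_dvd_X h)
    exact Submodule.mem_sup.2 ⟨X s * e, Ideal.mem_span_singleton'.2 ⟨e, mul_comm _ _⟩, w, hw,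
      by rw [← he]; ring⟩
  · intro h
    obtain ⟨j, hj, z, hz, rfl⟩ := Submodule.mem_sup.1 h
    rw [mul_add, pow_succ']
    exact add_mem (Ideal.mem_sup_left (Ideal.mul_mem_left _ _ hj))
      (Ideal.mem_sup_right (Ideal.mul_mem_mul (X_mem_maximalIdeal t) hz))

lemma length_quotient_X_sup_pow (s : Fin 2) (n : ℕ) : Module.length (MvPowerSeries (Fin 2) k)
    (MvPowerSeries (Fin 2) k ⧸ (Ideal.span {X s} ⊔ 𝔪 ^ n)) = n := by
  obtain ⟨t, h⟩ := exists_ne_fin_two s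
  induction n with
  | zero =>
    rw [Nat.cast_zero, Module.length_eq_zero_iff, Submodule.Quotient.subsingleton_iff]
    simp
  | succ n ih =>
    have h2 : Ideal.span {X s} ⊔ 𝔪 ^ (n + 1) ⊔ Ideal.span {X t} = 𝔪 := by
      apply le_antisymm
      · refine sup_le (sup_le ?_ (Ideal.pow_le_self n.succ_ne_zero)) ?_ <;>
        · rw [Ideal.span_singleton_le_iff_mem]
          exact X_mem_maximalIdeal _
      · rw [maximalIdeal_eq_span h, Ideal.span_insert]
        exact sup_le_sup_right le_sup_left _
    rw [length_quotient_eq_add (X_mul_mem_iff_of_ne h n), ih, h2, length_quotient_maximalIdeal]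
    simp

lemma length_quotient_X_mul_sup_pow (s : Fin 2) (F : MvPowerSeries (Fin 2) k) (n : ℕ) :
    Module.length (MvPowerSeries (Fin 2) k)
      (MvPowerSeries (Fin 2) k ⧸ (Ideal.span {X s * F} ⊔ 𝔪 ^ (n + 1))) =
    Module.length (MvPowerSeries (Fin 2) k)
      (MvPowerSeries (Fin 2) k ⧸ (Ideal.span {F} ⊔ 𝔪 ^ n)) + (n + 1 : ℕ) := by
  have h2 : Ideal.span {X s * F} ⊔ 𝔪 ^ (n + 1) ⊔ Ideal.span {X s} =
      Ideal.span {X s} ⊔ 𝔪 ^ (n + 1) := by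
    apply le_antisymm
    · refine sup_le (sup_le_sup_right ?_ _) le_sup_left
      rw [Ideal.span_singleton_le_span_singleton]
      exact dvd_mul_right _ _
    · exact sup_le le_sup_right (le_sup_of_le_left le_sup_right)
  rw [length_quotient_eq_add (X_mul_mem_iff s F n), h2, length_quotient_X_sup_pow]

/-- The Hilbert-Samuel function of `k[[X, Y]] / (f)` for a product `f` of `d` variables. -/
lemma exists_length_quotient_eq (l : List (Fin 2)) : ∃ c : ℕ, ∀ n : ℕ,
    (Module.length (MvPowerSeries (Fin 2) k) (MvPowerSeries (Fin 2) k ⧸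
      (Ideal.span {(l.map (X : Fin 2 → MvPowerSeries (Fin 2) k)).prod} ⊔ 𝔪 ^ (n + l.length)))) =
      (l.length * n + c : ℕ) := by
  induction l with
  | nil =>
    refine ⟨0, fun n => ?_⟩
    simp only [List.length_nil, zero_mul, zero_add, Nat.cast_zero]
    rw [Module.length_eq_zero_iff, Submodule.Quotient.subsingleton_iff, List.map_nil, List.prod_nil,
      Ideal.span_singleton_one, top_sup_eq]
  | cons s l ih =>
    obtain ⟨c, hc⟩ := ih
    -- The new variable contributes `n + l.length + 1`: its `n` raises the slope, the rest goes into
    -- the constant.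
    refine ⟨c + l.length + 1, fun n => ?_⟩
    rw [List.map_cons, List.prod_cons, List.length_cons, ← add_assoc,
      length_quotient_X_mul_sup_pow, hc, ← Nat.cast_add]
    congr 1
    ring

/-- The multiplicity of `k[[X, Y]] / (f)` is `d` for a product `f` of `d` variables. -/
lemma hilbertSamuelMultiplicity_eq {B : Type v} [CommRing B] (π : MvPowerSeries (Fin 2) k →+* B)
    (hπ : Function.Surjective π) {l : List (Fin 2)} (hl : l ≠ [])
    (hker : RingHom.ker π = Ideal.span {(l.map (X : Fin 2 → MvPowerSeries (Fin 2) k)).prod}) :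
    hilbertSamuelMultiplicity ((𝔪).map π) = l.length := by
  have hdim : ringKrullDim B = 1 := by
    rw [← ringKrullDim_eq_of_ringEquiv (RingHom.quotientKerEquivOfSurjective hπ), hker]
    apply ringKrullDim_quotient_span_singleton
    · refine List.prod_ne_zero fun h0 => ?_
      obtain ⟨s, -, hs⟩ := List.mem_map.1 h0
      exact (prime_X s).ne_zero hs
    · obtain ⟨s, hs⟩ := List.exists_mem_of_ne_nil l hl
      exact Ideal.mem_of_dvd _ (List.dvd_prod (List.mem_map_of_mem hs)) (X_mem_maximalIdeal s)
  -- Length does not change under restriction of scalars along the surjection `π`.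
  have hlen : ∀ n, Module.length B (B ⧸ (𝔪).map π ^ n) = Module.length (MvPowerSeries (Fin 2) k)
      (MvPowerSeries (Fin 2) k ⧸
        (Ideal.span {(l.map (X : Fin 2 → MvPowerSeries (Fin 2) k)).prod} ⊔ 𝔪 ^ n)) := by
    intro n
    let := π.toAlgebra
    have hker' : RingHom.ker ((Ideal.Quotient.mk ((𝔪).map π ^ n)).comp π) =
        Ideal.span {(l.map (X : Fin 2 → MvPowerSeries (Fin 2) k)).prod} ⊔ 𝔪 ^ n := by
      rw [← RingHom.comap_ker, Ideal.mk_ker, ← Ideal.map_pow,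
        Ideal.comap_map_of_surjective π hπ, sup_comm, ← hker]
      rfl
    rw [← Module.length_eq_of_surjective (S := MvPowerSeries (Fin 2) k) hπ, ← hker']
    symm
    refine LinearEquiv.length_eq ((Algebra.linearMap (MvPowerSeries (Fin 2) k)
      (B ⧸ (𝔪).map π ^ n)).quotKerEquivOfSurjective ?_)
    exact Ideal.Quotient.mk_surjective.comp hπ
  obtain ⟨c, hc⟩ := exists_length_quotient_eq (k := k) l
  have htend : Filter.Tendsto (fun n : ℕ =>
      ((Nat.factorial 1 : ℝ) * ((Module.length B (B ⧸ (𝔪).map π ^ n)).toNat : ℝ)) / (n : ℝ) ^ 1)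
      Filter.atTop (nhds (l.length : ℝ)) := by
    have hval : ∀ n : ℕ, l.length ≤ n → (Module.length B (B ⧸ (𝔪).map π ^ n)).toNat =
        (l.length : ℝ) * n + ((c : ℝ) - l.length * l.length) := by
      intro n hn
      obtain ⟨m, rfl⟩ := Nat.exists_eq_add_of_le' hn
      rw [hlen, hc, ENat.toNat_natCast]
      push_cast
      ring
    have h1 : Filter.Tendsto (fun n : ℕ => (l.length : ℝ) + ((c : ℝ) - l.length * l.length) / n)
        Filter.atTop (nhds (l.length + 0)) :=
      tendsto_const_nhds.add (tendsto_const_div_atTop_nhds_zero_nat _)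
    rw [add_zero] at h1
    refine h1.congr' ?_
    filter_upwards [Filter.eventually_ge_atTop l.length, Filter.eventually_ge_atTop 1] with n hn hn1
    have hn0 : (n : ℝ) ≠ 0 := by positivity
    rw [hval n hn, Nat.factorial_one, Nat.cast_one, one_mul, pow_one]
    field_simp
  rw [hilbertSamuelMultiplicity]
  simp only [hdim]
  rw [show ((1 : WithBot ℕ∞).unbotD 0).toNat = 1 from rfl]
  -- By uniqueness of limits the set in the definition is a singleton, so its `sInf` is the limit.
  have : {e : ℕ | Filter.Tendsto (fun n : ℕ =>
      ((Nat.factorial 1 : ℝ) * ((Module.length B (B ⧸ (𝔪).map π ^ n)).toNat : ℝ)) / (n : ℝ) ^ 1)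
      Filter.atTop (nhds (e : ℝ))} = {l.length} := by
    ext e
    refine ⟨fun he => ?_, fun he => ?_⟩
    · exact_mod_cast tendsto_nhds_unique he htend
    · rw [Set.mem_singleton_iff.1 he]
      exact htend
  rw [this, csInf_singleton]

end PowerSeriesRing
end RelationType
end

noncomputable section
namespace RelationType
open MvPowerSeries
universe u v

/-! ### The ring `k[[X, Y]] / (Xᵃ Y)` and its global relation type. -/

section Quotient
variable (k : Type u) [Field k] (a : ℕ)

local notation "𝔪" => IsLocalRing.maximalIdeal (MvPowerSeries (Fin 2) k)

/-- The projection `k[[X, Y]] → k[[X, Y]] / (Xᵃ Y)`. -/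
abbrev proj : MvPowerSeries (Fin 2) k →+* QuotXaY k a := Ideal.Quotient.mk _

variable {k a}

lemma proj_surjective : Function.Surjective (proj k a) := Ideal.Quotient.mk_surjective

lemma proj_eq_zero_iff {F : MvPowerSeries (Fin 2) k} : proj k a F = 0 ↔ X 0 ^ a * X 1 ∣ F := by
  rw [Ideal.Quotient.eq_zero_iff_mem, Ideal.mem_span_singleton]

lemma order_X_pow_mul_X :
    (X 0 ^ a * X 1 : MvPowerSeries (Fin 2) k).order = ((a + 1 : ℕ) : ℕ∞) := by
  rw [order_mul, order_X, X_pow_eq, order_monomial_of_ne_zero one_ne_zero]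
  simp

lemma X_pow_mul_X_ne_zero : (X 0 ^ a * X 1 : MvPowerSeries (Fin 2) k) ≠ 0 :=
  mul_ne_zero (pow_ne_zero _ (prime_X 0).ne_zero) (prime_X 1).ne_zero

lemma X_pow_mul_X_mem_maximalIdeal : (X 0 ^ a * X 1 : MvPowerSeries (Fin 2) k) ∈ 𝔪 :=
  Ideal.mul_mem_left _ _ (X_mem_maximalIdeal 1)

instance nontrivial_quotXaY : Nontrivial (QuotXaY k a) :=
  Ideal.Quotient.nontrivial_iff.2 fun h =>
    X_pow_mul_X_mem_maximalIdeal (Ideal.span_singleton_eq_top.1 h)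

instance isLocalRing_quotXaY : IsLocalRing (QuotXaY k a) :=
  IsLocalRing.of_surjective' (proj k a) proj_surjective

lemma maximalIdeal_quotXaY :
    IsLocalRing.maximalIdeal (QuotXaY k a) = (𝔪).map (proj k a) :=
  (IsLocalRing.map_maximalIdeal_of_surjective (proj k a) proj_surjective).symm

lemma proj_mem_maximalIdeal_iff {F : MvPowerSeries (Fin 2) k} :
    proj k a F ∈ IsLocalRing.maximalIdeal (QuotXaY k a) ↔ F ∈ 𝔪 := by
  refine ⟨fun h hF => h (hF.map _), fun h => ?_⟩
  rw [maximalIdeal_quotXaY]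
  exact Ideal.mem_map_of_mem _ h

/-- Multiples of `Xᵃ Y` have order at least `a + 1`, so components of degree at most `a` are well
defined on the quotient. -/
lemma homogeneousComponent_eq_of_proj_eq {n : ℕ} (hn : n ≤ a) {F G : MvPowerSeries (Fin 2) k}
    (h : proj k a F = proj k a G) : homogeneousComponent n F = homogeneousComponent n G := by
  rw [← sub_eq_zero, ← map_sub, proj_eq_zero_iff] at h
  obtain ⟨H, hH⟩ := h
  rw [← sub_eq_zero, ← map_sub]
  refine homogeneousComponent_of_lt_order_eq_zero ?_
  rw [hH, order_mul, order_X_pow_mul_X]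
  exact lt_of_lt_of_le (by exact_mod_cast Nat.lt_succ_of_le hn) le_self_add

lemma homogeneousComponent_zero_eq (F : MvPowerSeries (Fin 2) k) :
    homogeneousComponent 0 F = C (constantCoeff F) := by
  classical
  ext m
  rw [coeff_homogeneousComponent, coeff_C]
  simp only [Finsupp.degree_eq_zero_iff]
  split_ifs with h
  · rw [h, coeff_zero_eq_constantCoeff_apply]
  · rfl

lemma homogeneousComponent_one_X (s : Fin 2) :
    homogeneousComponent 1 (X s : MvPowerSeries (Fin 2) k) = X s := by
  classical
  ext m
  rw [coeff_homogeneousComponent, coeff_X]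
  split_ifs with h h' h'
  · rfl
  · rfl
  · simp [h'] at h
  · rfl

variable (k a) in
/-- The action of `k[[X, Y]] / (Xᵃ Y)` on `k[[X, Y]]` through the residue field `k`. -/
abbrev residueAlgebra : Algebra (QuotXaY k a) (MvPowerSeries (Fin 2) k) :=
  (Ideal.Quotient.lift _ (C.comp constantCoeff) (by
    intro F hF
    obtain ⟨G, rfl⟩ := Ideal.mem_span_singleton.1 hF
    simp) : QuotXaY k a →+* MvPowerSeries (Fin 2) k).toAlgebra

attribute [local instance] residueAlgebra

lemma algebraMap_proj (F : MvPowerSeries (Fin 2) k) :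
    algebraMap (QuotXaY k a) (MvPowerSeries (Fin 2) k) (proj k a F) = homogeneousComponent 0 F := by
  rw [homogeneousComponent_zero_eq]
  rfl

/-- Each element of the maximal ideal of `k[[X, Y]] / (Xᵃ Y)` has a linear part. -/
lemma exists_linearPart (ha : 1 ≤ a) :
    ∃ L : IsLocalRing.maximalIdeal (QuotXaY k a) →ₗ[QuotXaY k a] MvPowerSeries (Fin 2) k,
      ∀ (F : MvPowerSeries (Fin 2) k) (hF : proj k a F ∈ IsLocalRing.maximalIdeal (QuotXaY k a)),
        L ⟨proj k a F, hF⟩ = homogeneousComponent 1 F := by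
  -- A section of sets only; since `1 ≤ a`, linear parts do not depend on the representative, which
  -- gives additivity and linearity.
  choose σ hσ using (proj_surjective : Function.Surjective (proj k a))
  refine ⟨⟨⟨fun z => homogeneousComponent 1 (σ z.1), fun z w => ?_⟩, fun c z => ?_⟩, fun F hF => ?_⟩
  · rw [← map_add]
    exact homogeneousComponent_eq_of_proj_eq ha (by simp [hσ])
  · rw [RingHom.id_apply, Algebra.smul_def]
    conv_rhs => rw [← hσ c, algebraMap_proj]
    rw [← homogeneousComponent_mul_of_le_order (by simp), zero_add]
    · exact homogeneousComponent_eq_of_proj_eq ha (by simp [hσ])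
    · rw [Nat.cast_one, ← mem_maximalIdeal_iff_order, ← proj_mem_maximalIdeal_iff (a := a), hσ]
      exact z.2
  · exact homogeneousComponent_eq_of_proj_eq ha (hσ _)

/-- The morphism from the symmetric algebra of the maximal ideal to `k[[X, Y]]` induced by the
linear part sees the initial forms. -/
lemma exists_lift_of_mem_symDegree
    {L : IsLocalRing.maximalIdeal (QuotXaY k a) →ₗ[QuotXaY k a] MvPowerSeries (Fin 2) k}
    (hL : ∀ (F : MvPowerSeries (Fin 2) k) (hF : proj k a F ∈ IsLocalRing.maximalIdeal (QuotXaY k a)),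
        L ⟨proj k a F, hF⟩ = homogeneousComponent 1 F) (n : ℕ)
    {s : SymmetricAlgebra (QuotXaY k a) (IsLocalRing.maximalIdeal (QuotXaY k a))}
    (hs : s ∈ symDegree (IsLocalRing.maximalIdeal (QuotXaY k a)) n) :
    ∃ F : MvPowerSeries (Fin 2) k, (n : ℕ∞) ≤ F.order ∧
      symToPoly (IsLocalRing.maximalIdeal (QuotXaY k a)) s = Polynomial.monomial n (proj k a F) ∧
      SymmetricAlgebra.lift L s = homogeneousComponent n F := by
  induction n generalizing s with
  | zero =>
    rw [symDegree, pow_zero, Submodule.mem_one] at hs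
    obtain ⟨r, rfl⟩ := hs
    obtain ⟨F, rfl⟩ := proj_surjective r
    refine ⟨F, by simp, ?_, ?_⟩
    · rw [AlgHom.commutes, Polynomial.monomial_zero_left, Polynomial.algebraMap_eq]
    · rw [AlgHom.commutes, algebraMap_proj]
  | succ n ih =>
    rw [symDegree_add, symDegree_one] at hs
    induction hs using Submodule.mul_induction_on' with
    | mem_mul_mem s hs z hz =>
      obtain ⟨⟨z, hz⟩, rfl⟩ := hz
      obtain ⟨G, rfl⟩ := proj_surjective z
      obtain ⟨F, hF, h1, h2⟩ := ih hs
      have hG : ((1 : ℕ) : ℕ∞) ≤ G.order := by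
        rw [Nat.cast_one, ← mem_maximalIdeal_iff_order, ← proj_mem_maximalIdeal_iff (a := a)]
        exact hz
      refine ⟨F * G, ?_, ?_, ?_⟩
      · rw [order_mul, Nat.cast_add]
        exact add_le_add hF hG
      · rw [map_mul, h1, symToPoly_ι, Polynomial.monomial_mul_monomial,
          map_mul (proj k a)]
      · rw [map_mul, h2, SymmetricAlgebra.lift_ι_apply, hL,
          homogeneousComponent_mul_of_le_order hF hG]
    | add s _ t _ hs ht =>
      obtain ⟨F, hF, h1, h2⟩ := hs
      obtain ⟨G, hG, h3, h4⟩ := ht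
      exact ⟨F + G, (le_min hF hG).trans min_order_le_add, by simp only [map_add, h1, h3],
        by simp only [map_add, h2, h4]⟩

/-- The relation `Xᵃ Y = 0` is an effective relation of the maximal ideal. -/
lemma not_subsingleton_effectiveRelations_maximalIdeal (ha : 1 ≤ a) : ¬ Subsingleton
    (EffectiveRelations (IsLocalRing.maximalIdeal (QuotXaY k a)) (a + 1)) := by
  rw [subsingleton_effectiveRelations_iff, Nat.add_sub_cancel]
  intro hle
  obtain ⟨L, hL⟩ := exists_linearPart (k := k) ha
  have hx : ∀ s, proj k a (X s) ∈ IsLocalRing.maximalIdeal (QuotXaY k a) := fun s =>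
    proj_mem_maximalIdeal_iff.2 (X_mem_maximalIdeal s)
  have hmem : SymmetricAlgebra.ι (QuotXaY k a) _ ⟨_, hx 0⟩ ^ a *
      SymmetricAlgebra.ι (QuotXaY k a) _ ⟨_, hx 1⟩ ∈
      kerDegree (IsLocalRing.maximalIdeal (QuotXaY k a)) (a + 1) := by
    refine (mem_kerDegree _).2 ⟨?_, ?_⟩
    · rw [map_mul, map_pow, symToPoly_ι, symToPoly_ι, Polynomial.monomial_pow,
        Polynomial.monomial_mul_monomial, ← map_pow, ← map_mul, proj_eq_zero_iff.2 dvd_rfl, map_zero]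
    · rw [symDegree_add, symDegree_one, symDegree]
      exact Submodule.mul_mem_mul (Submodule.pow_mem_pow _ (LinearMap.mem_range_self _ _) a)
        (LinearMap.mem_range_self _ _)
  -- A relation of degree `a` has a representative in `(Xᵃ Y)`, whose component of degree `a`
  -- vanishes. So the linear-part morphism kills every non-effective relation of degree `a + 1`.
  have hker : symDegree (IsLocalRing.maximalIdeal (QuotXaY k a)) 1 * kerDegree _ a ≤
      LinearMap.ker (SymmetricAlgebra.lift L).toLinearMap := by
    rw [Submodule.mul_le]
    intro z _ w hw
    rw [mem_kerDegree] at hw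
    obtain ⟨F, hF, h1, h2⟩ := exists_lift_of_mem_symDegree hL a hw.2
    rw [hw.1, eq_comm, Polynomial.monomial_eq_zero_iff, ← map_zero (proj k a)] at h1
    rw [LinearMap.mem_ker, AlgHom.toLinearMap_apply, map_mul, h2,
      homogeneousComponent_eq_of_proj_eq le_rfl h1, map_zero, mul_zero]
  have h0 := hker (hle hmem)
  rw [LinearMap.mem_ker, AlgHom.toLinearMap_apply, map_mul, map_pow, SymmetricAlgebra.lift_ι_apply,
    SymmetricAlgebra.lift_ι_apply, hL, hL, homogeneousComponent_one_X,
    homogeneousComponent_one_X] at h0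
  exact X_pow_mul_X_ne_zero h0

/-- For divisors of `Xᵃ Y`, ideal membership in the quotient becomes divisibility in `k[[X, Y]]`,
where the variables are prime. -/
lemma proj_mem_span_iff {F G : MvPowerSeries (Fin 2) k} (hG : G ∣ X 0 ^ a * X 1) :
    proj k a F ∈ Ideal.span {proj k a G} ↔ G ∣ F := by
  rw [Ideal.mem_span_singleton]
  refine ⟨?_, fun h => map_dvd _ h⟩
  rintro ⟨c, hc⟩
  obtain ⟨c, rfl⟩ := proj_surjective c
  rw [← map_mul, ← sub_eq_zero, ← map_sub, proj_eq_zero_iff] at hc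
  exact (dvd_sub_left (dvd_mul_right G c)).1 (hG.trans hc)

lemma mem_span_X_pow_of_mul_eq_zero (ha : 1 ≤ a) {f w : QuotXaY k a} (h : f * w = 0)
    (hf : f ∉ Ideal.span {proj k a (X 0)}) : w ∈ Ideal.span {proj k a (X 0)} ^ a := by
  obtain ⟨f, rfl⟩ := proj_surjective f
  obtain ⟨w, rfl⟩ := proj_surjective w
  rw [proj_mem_span_iff (Dvd.dvd.mul_right (dvd_pow_self _ (by lia)) _)] at hf
  rw [Ideal.span_singleton_pow, ← map_pow, proj_mem_span_iff (dvd_mul_right _ _)]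
  rw [← map_mul, proj_eq_zero_iff] at h
  exact (prime_X 0).pow_dvd_of_dvd_mul_left a hf (dvd_of_mul_right_dvd h)

lemma mem_span_X_one_of_mul_eq_zero {f w : QuotXaY k a} (h : f * w = 0)
    (hf : f ∉ Ideal.span {proj k a (X 1)}) : w ∈ Ideal.span {proj k a (X 1)} := by
  obtain ⟨f, rfl⟩ := proj_surjective f
  obtain ⟨w, rfl⟩ := proj_surjective w
  rw [proj_mem_span_iff (dvd_mul_left _ _)] at hf ⊢
  rw [← map_mul, proj_eq_zero_iff] at h
  exact ((prime_X 1).dvd_or_dvd (dvd_of_mul_left_dvd h)).resolve_left hf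

lemma span_X_pow_inf_span_X_one :
    Ideal.span {proj k a (X 0)} ^ a ⊓ Ideal.span {proj k a (X 1)} = ⊥ := by
  rw [eq_bot_iff]
  rintro w ⟨h0, h1⟩
  obtain ⟨w, rfl⟩ := proj_surjective w
  rw [SetLike.mem_coe, Ideal.span_singleton_pow, ← map_pow, proj_mem_span_iff (dvd_mul_right _ _)] at h0
  rw [SetLike.mem_coe, proj_mem_span_iff (dvd_mul_left _ _)] at h1
  obtain ⟨c, rfl⟩ := h0
  have h : X 1 ∣ c := ((prime_X 1).dvd_or_dvd h1).resolve_left fun h =>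
    not_X_dvd_X one_ne_zero ((prime_X 1).dvd_of_dvd_pow h)
  rw [Ideal.mem_bot, proj_eq_zero_iff]
  exact mul_dvd_mul_left _ h

instance isPrincipalIdealRing_quotient_span (s : Fin 2) :
    IsPrincipalIdealRing (QuotXaY k a ⧸ Ideal.span {proj k a (X s)}) :=
  isPrincipalIdealRing_of_surjective (B := QuotXaY k a ⧸ Ideal.span {proj k a (X s)})
    ((Ideal.Quotient.mk (Ideal.span {proj k a (X s)})).comp (proj k a))
    ((Ideal.Quotient.mk_surjective (I := Ideal.span {proj k a (X s)})).comp proj_surjective) s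
    (Ideal.Quotient.eq_zero_iff_mem.2 (Ideal.mem_span_singleton_self _))

theorem grt_quotXaY (ha : 1 ≤ a) : grt (QuotXaY k a) = (a : ℕ∞) + 1 := by
  apply le_antisymm
  · exact iSup_le fun I => rt_le_of_isPrincipalIdealRing_quotient
      (Ideal.span {proj k a (X 0)}) (Ideal.span {proj k a (X 1)})
      (fun _ _ h hf => mem_span_X_pow_of_mul_eq_zero ha h hf)
      (fun _ _ h hf => mem_span_X_one_of_mul_eq_zero h hf) span_X_pow_inf_span_X_one I
  · refine le_trans (le_leastPos fun r _ hr => ?_)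
      (le_iSup rt (IsLocalRing.maximalIdeal (QuotXaY k a)))
    by_contra hlt
    refine not_subsingleton_effectiveRelations_maximalIdeal ha (hr (a + 1) ?_)
    have : r < a + 1 := by exact_mod_cast not_le.1 hlt
    lia

end Quotient
end RelationType
end

noncomputable section
namespace RelationType
open MvPowerSeries
universe u v

/-! ### Minimal primary components and `brt` when `(0) = Jᵃ ∩ K`. -/

section Components
variable {A : Type u} [CommRing A]

/-- As `q M = 0 ⊆ Q`, an element of `M` outside the radical of `Q` can be cancelled. -/
lemma le_of_isPrimary_of_inf_eq_bot {q Q M : Ideal A} (hQ : Q.IsPrimary) (h : q ⊓ M = ⊥)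
    (hM : ¬ M ≤ Q.radical) : q ≤ Q := by
  obtain ⟨m, hm, hmQ⟩ := SetLike.not_le_iff_exists.1 hM
  intro z hz
  have h0 : z * m ∈ q ⊓ M := ⟨q.mul_mem_right _ hz, M.mul_mem_left _ hm⟩
  rw [h, Ideal.mem_bot] at h0
  exact ((Ideal.isPrimary_iff.1 hQ).2 (h0 ▸ Q.zero_mem : z * m ∈ Q)).resolve_right hmQ

open Classical in
/-- Uniqueness of the primary components belonging to minimal primes. -/
lemma eq_of_mem_isMinimalPrimaryDecomposition {t : Finset (Ideal A)}
    (ht : Submodule.IsMinimalPrimaryDecomposition (⊥ : Ideal A) t) {q Q L : Ideal A} (hq : q ∈ t)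
    (hmin : q.radical ∈ minimalPrimes A) (hQ : Q.IsPrimary) (hrad : Q.radical = q.radical)
    (h : Q ⊓ L = ⊥) (hL : ¬ L ≤ q.radical) : q = Q := by
  have hqp : q.IsPrimary := ht.primary hq
  refine le_antisymm (le_of_isPrimary_of_inf_eq_bot hQ (M := (t.erase q).inf id) ?_ ?_)
    (le_of_isPrimary_of_inf_eq_bot hqp h hL)
  · rw [← ht.inf_eq]
    conv_rhs => rw [← Finset.insert_erase hq, Finset.inf_insert, id]
  -- A minimal prime containing the intersection of the other components would contain one of them,
  -- and by minimality equal its radical, against distinctness of radicals.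
  · rw [hrad]
    intro hle
    obtain ⟨q', hq', hle'⟩ := (Ideal.IsPrime.inf_le' hmin.1.1).1 hle
    obtain ⟨hne, hq't⟩ := Finset.mem_erase.1 hq'
    have hrad' : q'.radical ≤ q.radical := (hmin.1.1.radical_le_iff).2 hle'
    have heq : q'.radical = q.radical := le_antisymm hrad'
      (hmin.2 ⟨Ideal.isPrime_radical (ht.primary hq't), bot_le⟩ hrad')
    refine ht.distinct hq't hq hne ?_
    simpa only [Function.onFun, Submodule.colon_univ] using heq

variable {J K : Ideal A} {a : ℕ}

/-- Every prime contains `Jᵃ ∩ K = 0`, hence `J` or `K`. -/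
lemma minimalPrimes_eq_pair [hJ : J.IsPrime] [hK : K.IsPrime] (h0 : J ^ a ⊓ K = ⊥) (hJK : ¬ J ≤ K)
    (hKJ : ¬ K ≤ J) : minimalPrimes A = {J, K} := by
  have hle : ∀ P : Ideal A, P.IsPrime → J ≤ P ∨ K ≤ P := fun P hP =>
    (hP.inf_le.1 (h0.le.trans bot_le)).imp_left hP.le_of_pow_le
  ext P
  constructor
  · intro hP
    exact (hle P hP.1.1).imp (fun h => le_antisymm (hP.2 ⟨hJ, bot_le⟩ h) h)
      fun h => le_antisymm (hP.2 ⟨hK, bot_le⟩ h) h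
  · rintro (rfl | rfl)
    · refine ⟨⟨hJ, bot_le⟩, fun Q hQ hQP => ?_⟩
      exact (hle Q hQ.1).resolve_right fun h => hKJ (h.trans hQP)
    · refine ⟨⟨hK, bot_le⟩, fun Q hQ hQP => ?_⟩
      exact (hle Q hQ.1).resolve_left fun h => hJK (h.trans hQP)

open Classical in
lemma isMinimalPrimaryDecomposition_pair [hJ : J.IsPrime] [hK : K.IsPrime] (ha : a ≠ 0)
    (hP : (J ^ a).IsPrimary) (h0 : J ^ a ⊓ K = ⊥) (hJK : ¬ J ≤ K) (hKJ : ¬ K ≤ J) :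
    Submodule.IsMinimalPrimaryDecomposition (⊥ : Ideal A) {J ^ a, K} := by
  have h1 : ¬ J ^ a ≤ K := fun h => hJK (hK.le_of_pow_le h)
  have h2 : ¬ K ≤ J ^ a := fun h => hKJ (h.trans (Ideal.pow_le_self ha))
  have hne : J ^ a ≠ K := fun h => h1 h.le
  have hr : (J ^ a).radical = J := by rw [Ideal.radical_pow _ ha, hJ.radical]
  refine ⟨?_, ?_, ?_, ?_⟩
  · rw [Finset.inf_insert, Finset.inf_singleton, id, id, h0]
  · simp only [Finset.mem_insert, Finset.mem_singleton]
    rintro _ (rfl | rfl)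
    · exact hP
    · exact hK.isPrimary
  · simp only [Finset.coe_insert, Finset.coe_singleton]
    rw [Set.pairwise_pair]
    intro _
    simp only [Function.onFun, Submodule.colon_univ, hr, hK.radical]
    exact ⟨fun h => hJK h.le, fun h => hKJ h.le⟩
  · simp only [Finset.mem_insert, Finset.mem_singleton]
    rintro _ (rfl | rfl)
    · rwa [Finset.erase_insert (by simpa using hne), Finset.inf_singleton]
    · rwa [Finset.pair_comm, Finset.erase_insert (by simpa using hne.symm), Finset.inf_singleton]

lemma minimalPrimaryComponents_eq_pair [hJ : J.IsPrime] [hK : K.IsPrime] (ha : a ≠ 0)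
    (hP : (J ^ a).IsPrimary) (h0 : J ^ a ⊓ K = ⊥) (hJK : ¬ J ≤ K) (hKJ : ¬ K ≤ J) :
    minimalPrimaryComponents A = {J ^ a, K} := by
  classical
  have hmin := minimalPrimes_eq_pair h0 hJK hKJ
  have hr : (J ^ a).radical = J := by rw [Ideal.radical_pow _ ha, hJ.radical]
  ext q
  constructor
  · rintro ⟨t, ht, hqt, hq⟩
    have hq' := hq
    rw [hmin] at hq'
    rcases hq' with h | h
    · left
      exact eq_of_mem_isMinimalPrimaryDecomposition (by convert ht) hqt hq hP (by rw [hr, h]) h0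
        (by rwa [h])
    · right
      exact eq_of_mem_isMinimalPrimaryDecomposition (by convert ht) hqt hq hK.isPrimary
        (by rw [hK.radical, h]) (by rwa [inf_comm]) (by rw [h]; exact fun h => hJK (hK.le_of_pow_le h))
  · intro h
    refine ⟨{J ^ a, K}, by convert isMinimalPrimaryDecomposition_pair ha hP h0 hJK hKJ,
      by simpa using h, ?_⟩
    rw [hmin]
    rcases h with rfl | rfl
    · exact Or.inl hr
    · exact Or.inr hK.radical

/-- The sets `{Jᵃ}`, `{K}` and `{Jᵃ, K}` give at most `a + 1`, `1 + a` and `(a + 1) + 0`. Upper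
bounds on the exponents suffice, because the last set attains the value. -/
lemma brt_eq_of_components [IsLocalRing A] [hJ : J.IsPrime] [hK : K.IsPrime] (ha : a ≠ 0)
    (hP : (J ^ a).IsPrimary) (h0 : J ^ a ⊓ K = ⊥) (hJK : ¬ J ≤ K) (hKJ : ¬ K ≤ J)
    (h1 : hilbertSamuelMultiplicity
      ((IsLocalRing.maximalIdeal A).map (Ideal.Quotient.mk (J ^ a))) = a)
    (h2 : hilbertSamuelMultiplicity
      ((IsLocalRing.maximalIdeal A).map (Ideal.Quotient.mk K)) = 1)
    (h3 : hilbertSamuelMultiplicity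
      ((IsLocalRing.maximalIdeal A).map (Ideal.Quotient.mk (⊥ : Ideal A))) = a + 1) :
    brt A = (a : ℕ∞) + 1 := by
  have hc := minimalPrimaryComponents_eq_pair ha hP h0 hJK hKJ
  have hr : (J ^ a).radical = J := by rw [Ideal.radical_pow _ ha, hJ.radical]
  have hr1 : radicalExponent (J ^ a) ≤ a := leastPos_le (Nat.one_le_iff_ne_zero.2 ha) (by rw [hr])
  have hr2 : radicalExponent K ≤ (1 : ℕ) := leastPos_le le_rfl (by rw [hK.radical, pow_one])
  have hnil : nilExponent A ≤ (a : ℕ∞) + 1 := by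
    refine leastPos_le (n := a + 1) (Nat.le_add_left 1 a) (le_bot_iff.1 ?_)
    have hN : ∀ P : Ideal A, P.IsPrime → nilradical A ≤ P := fun P hP => by
      rw [nilradical, hP.radical_le_iff]; exact bot_le
    rw [pow_succ, ← h0]
    exact le_inf (Ideal.mul_le_left.trans (Ideal.pow_right_mono (hN J hJ) a))
      (Ideal.mul_le_right.trans (hN K hK))
  -- The ideal occurs in the type of the quotient ring, so the equality is substituted rather than
  -- rewritten.
  have hmult : ∀ {S : Set (Ideal A)} {Q : Ideal A}, sInf S = Q →
      hilbertSamuelMultiplicity ((IsLocalRing.maximalIdeal A).map (Ideal.Quotient.mk (sInf S))) =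
        hilbertSamuelMultiplicity ((IsLocalRing.maximalIdeal A).map (Ideal.Quotient.mk Q)) := by
    rintro S Q rfl
    rfl
  have hcompl : ∀ (S : Set (Ideal A)) (m : ℕ∞),
      (J ^ a ∉ S → radicalExponent (J ^ a) ≤ m) → (K ∉ S → radicalExponent K ≤ m) →
      complExponent A S ≤ m := by
    intro S m hm1 hm2
    refine iSup₂_le fun q hq => ?_
    rw [hc] at hq
    obtain ⟨rfl | rfl, hqS⟩ := hq
    · exact hm1 hqS
    · exact hm2 hqS
  apply le_antisymm
  · refine sup_le hnil (iSup_le fun S => iSup_le fun hS => iSup_le fun hSne => ?_)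
    rw [hc] at hS
    rcases Set.subset_pair_iff_eq.1 hS with rfl | rfl | rfl | rfl
    · exact absurd hSne Set.not_nonempty_empty
    · rw [hmult sInf_singleton, h1]
      exact add_le_add le_rfl (hcompl _ _ (fun h => absurd rfl h) fun _ => hr2)
    · rw [hmult sInf_singleton, h2, add_comm]
      exact add_le_add (hcompl _ _ (fun _ => hr1) fun h => absurd rfl h) le_rfl
    · rw [hmult (sInf_pair.trans h0), h3]
      refine (add_le_add (by simp) (hcompl _ 0 (fun h => absurd (by simp) h)
        fun h => absurd (by simp) h)).trans (add_zero _).le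
  · refine le_sup_of_le_right (le_iSup_of_le {J ^ a, K} (le_iSup_of_le hc.ge
      (le_iSup_of_le (Set.insert_nonempty _ _) ?_)))
    rw [hmult (sInf_pair.trans h0), h3]
    exact le_add_right (by simp)

end Components

/-! ### The value of `brt` for `k[[X, Y]] / (Xᵃ Y)`. -/

section Quotient
variable {k : Type u} [Field k] {a : ℕ}

lemma isPrime_span_proj_X (ha : 1 ≤ a) (s : Fin 2) : (Ideal.span {proj k a (X s)}).IsPrime := by
  have hd : (X s : MvPowerSeries (Fin 2) k) ∣ X 0 ^ a * X 1 := by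
    fin_cases s
    · exact Dvd.dvd.mul_right (dvd_pow_self _ (by lia)) _
    · exact dvd_mul_left _ _
  refine ⟨?_, fun {f w} h => ?_⟩
  · rw [Ne, Ideal.eq_top_iff_one, ← map_one (proj k a), proj_mem_span_iff hd]
    exact (prime_X s).not_dvd_one
  · obtain ⟨f, rfl⟩ := proj_surjective f
    obtain ⟨w, rfl⟩ := proj_surjective w
    rw [← map_mul, proj_mem_span_iff hd] at h
    rw [proj_mem_span_iff hd, proj_mem_span_iff hd]
    exact (prime_X s).dvd_or_dvd h

lemma isPrimary_span_proj_X_pow (ha : 1 ≤ a) : (Ideal.span {proj k a (X 0)} ^ a).IsPrimary := by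
  have hP := isPrime_span_proj_X (k := k) ha 0
  rw [Ideal.isPrimary_iff, Ideal.radical_pow _ (by lia), hP.radical]
  refine ⟨fun h => hP.ne_top (top_le_iff.1 (h.ge.trans (Ideal.pow_le_self (by lia)))), ?_⟩
  intro f w h
  obtain ⟨f, rfl⟩ := proj_surjective f
  obtain ⟨w, rfl⟩ := proj_surjective w
  rw [Ideal.span_singleton_pow, ← map_pow, ← map_mul, proj_mem_span_iff (dvd_mul_right _ _)] at h
  rw [Ideal.span_singleton_pow, ← map_pow, proj_mem_span_iff (dvd_mul_right _ _),
    proj_mem_span_iff (Dvd.dvd.mul_right (dvd_pow_self _ (by lia)) _), or_iff_not_imp_right]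
  exact fun hw => (prime_X 0).pow_dvd_of_dvd_mul_right a hw h

lemma hilbertSamuelMultiplicity_quotXaY {Q : Ideal (QuotXaY k a)} {l : List (Fin 2)} (hl : l ≠ [])
    (hd : (l.map (X : Fin 2 → MvPowerSeries (Fin 2) k)).prod ∣ X 0 ^ a * X 1)
    (hQ : Q = Ideal.span {proj k a (l.map (X : Fin 2 → MvPowerSeries (Fin 2) k)).prod}) :
    hilbertSamuelMultiplicity
      ((IsLocalRing.maximalIdeal (QuotXaY k a)).map (Ideal.Quotient.mk Q)) = l.length := by
  rw [maximalIdeal_quotXaY, Ideal.map_map]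
  refine hilbertSamuelMultiplicity_eq _ ((Ideal.Quotient.mk_surjective (I := Q)).comp proj_surjective) hl ?_
  ext F
  rw [RingHom.mem_ker, RingHom.comp_apply, Ideal.Quotient.eq_zero_iff_mem, hQ, proj_mem_span_iff hd,
    Ideal.mem_span_singleton]

theorem brt_quotXaY (ha : 1 ≤ a) : brt (QuotXaY k a) = (a : ℕ∞) + 1 := by
  have h0 := isPrime_span_proj_X (k := k) ha 0
  have h1 := isPrime_span_proj_X (k := k) ha 1
  have hd0 : (X 0 : MvPowerSeries (Fin 2) k) ∣ X 0 ^ a * X 1 :=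
    Dvd.dvd.mul_right (dvd_pow_self _ (by lia)) _
  have hd1 : (X 1 : MvPowerSeries (Fin 2) k) ∣ X 0 ^ a * X 1 := dvd_mul_left _ _
  have hprod : ((List.replicate a (0 : Fin 2)).map (X : Fin 2 → MvPowerSeries (Fin 2) k)).prod = X 0 ^ a := by
    rw [List.map_replicate, List.prod_replicate]
  have hprod' : ((List.replicate a (0 : Fin 2) ++ [1]).map (X : Fin 2 → MvPowerSeries (Fin 2) k)).prod =
      X 0 ^ a * X 1 := by
    rw [List.map_append, List.prod_append, hprod, List.map_singleton, List.prod_singleton]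
  refine brt_eq_of_components (J := Ideal.span {proj k a (X 0)}) (K := Ideal.span {proj k a (X 1)})
    (by lia) (isPrimary_span_proj_X_pow ha) span_X_pow_inf_span_X_one ?_ ?_ ?_ ?_ ?_
  · rw [Ideal.span_singleton_le_iff_mem, proj_mem_span_iff hd1]
    exact not_X_dvd_X one_ne_zero
  · rw [Ideal.span_singleton_le_iff_mem, proj_mem_span_iff hd0]
    exact not_X_dvd_X zero_ne_one
  · rw [hilbertSamuelMultiplicity_quotXaY (l := List.replicate a (0 : Fin 2)) ?_ ?_ ?_, List.length_replicate]
    · rw [Ne, List.replicate_eq_nil_iff]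
      lia
    · rw [hprod]
      exact dvd_mul_right _ _
    · rw [hprod, map_pow, Ideal.span_singleton_pow]
  · rw [hilbertSamuelMultiplicity_quotXaY (l := [1]) (by simp) (by simp) (by simp),
      List.length_singleton]
  · rw [hilbertSamuelMultiplicity_quotXaY (l := List.replicate a (0 : Fin 2) ++ [1]) (by simp) ?_ ?_,
      List.length_append, List.length_replicate, List.length_singleton]
    · rw [hprod']
    -- The zero ideal is treated as the one generated by the image of the full monomial `Xᵃ Y`.
    · rw [hprod', proj_eq_zero_iff.2 dvd_rfl, Ideal.span_singleton_eq_bot.2 rfl]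

end Quotient
end RelationType
end

theorem mainTheorem10 {k : Type*} [Field k] (a : ℕ) (ha : 1 ≤ a) :
    ∃ _ : IsLocalRing (RelationType.QuotXaY k a),
      IsNoetherianRing (RelationType.QuotXaY k a) ∧
      RelationType.IsCompleteIntersectionLocal (RelationType.QuotXaY k a) ∧
      ringKrullDim (RelationType.QuotXaY k a) = 1 ∧
      RelationType.grt (RelationType.QuotXaY k a) = (a : ℕ∞) + 1 ∧
      RelationType.brt (RelationType.QuotXaY k a) = (a : ℕ∞) + 1 :=
  ⟨RelationType.isLocalRing_quotXaY, inferInstance,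
    RelationType.isCompleteIntersectionLocal_quotient RelationType.X_pow_mul_X_ne_zero
      RelationType.X_pow_mul_X_mem_maximalIdeal,
    RelationType.ringKrullDim_quotient_span_singleton RelationType.X_pow_mul_X_ne_zero
      RelationType.X_pow_mul_X_mem_maximalIdeal,
    RelationType.grt_quotXaY ha, RelationType.brt_quotXaY ha⟩
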